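/- Let $k$ be a field of characteristic zero, let $s, t \geq 1$ and $u \geq 0$ be integers, and let $c_1, c_2 \in k$ be nonzero. Then the $k$-derivation $d = \partial_x + x^u(c_1 x^t y^s + c_2)\,\partial_y$ of the polynomial ring $k[x,y]$ is simple; that is, the only ideals $I$ of $k[x,y]$ with $d(I) \subseteq I$ are $\{0\}$ and $k[x,y]$. -/

import Mathlib

/-- An ideal `I` of `A` is `d`-differential if `d(I) ⊆ I`. -/
def Derivation.IsDifferentialIdeal {k A : Type*} [CommRing k] [CommRing A] [Algebra k A]
    (d : Derivation k A A) (I : Ideal A) : Prop :=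
  ∀ f ∈ I, d f ∈ I

/-- A derivation `d` of `A` is simple if `{0}` and `A` are the only `d`-differential ideals. -/
def Derivation.IsSimpleDerivation {k A : Type*} [CommRing k] [CommRing A] [Algebra k A]
    (d : Derivation k A A) : Prop :=
  ∀ I : Ideal A, d.IsDifferentialIdeal I → I = ⊥ ∨ I = ⊤

/-! Give `x ^ i * y ^ j` the weight `t * j - s * i`. Then `x ^ t * y ^ s` has weight `0`, so the
`∂_y` part of the derivation is homogeneous of weight `-(s * u + t)`, while `∂_x` has weight `s`;
the gap is `δ = s + t + s * u`. With `v ^ s` standing for `x ^ t * y ^ s`, each layer of fixed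
weight becomes a polynomial in `v`, and the `∂_y` part acts as `P * d/dv`, where `P = c₁ * v ^ s +
c₂` is squarefree.

Let `f` be a Darboux polynomial with cofactor `l`, of degree `N > 0` in `y`, and let `F` be its
lowest layer, of weight `n₀`. The lowest weight gives `P * F' = L * F`, and a pole count kills the
layers of `l` strictly between its first one and the one `δ` higher. At distance `δ` the operator
`∂_x` enters for the first time, and the resulting equation is solvable only if `-s * n₀ * c₁ + t *
L.coeff (s - 1) = 0` (`coeff_relation_of_layers`). The leading coefficient in `y` gives `L.coeff (s
- 1) = N * c₁` (`coeff_cofactor`), and `F(0) ≠ 0` gives `n₀ = -s * i` with `i ≥ 0`. Hence `s ^ 2 * i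
+ t * N = 0`, which is absurd (`natDegree_eq_zero_of_yFlow_eq_mul`).

In a nonzero differential ideal, the primitive part of an element of least degree in `y` is Darboux.
The ideal therefore contains a nonzero polynomial in `x`, and differentiating it yields a unit. -/

/-! ### Poles of rational functions and first order equations in one variable -/

section OneVariable

open Polynomial

variable {k : Type*} [Field k]

/-- If the polynomial `P ^ i * (B / A)'` has no pole at the irreducible factor `q` of `A`,
then `P ^ i` absorbs the pole of `(B / A)'`, whose order is one more than that of `B / A`. -/
lemma pow_succ_dvd_of_wronskian [CharZero k] {P A₀ B R q : k[X]} {i m : ℕ} (hq : Irreducible q)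
    (hA₀ : ¬ q ∣ A₀) (hB : ¬ q ∣ B)
    (h : P ^ i * (derivative B * (q ^ (m + 1) * A₀) - B * derivative (q ^ (m + 1) * A₀)) =
      R * (q ^ (m + 1) * A₀) ^ 2) : q ^ (m + 2) ∣ P ^ i := by
  have hp : Prime q := hq.prime
  set W := q * (derivative B * A₀ - B * derivative A₀) - C ((m : k) + 1) * derivative q * A₀ * B
    with hW
  have hqW : ¬ q ∣ W := by
    intro hd
    have h1 : q ∣ C ((m : k) + 1) * derivative q * A₀ * B := by
      have := dvd_sub (dvd_mul_right q (derivative B * A₀ - B * derivative A₀)) hd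
      rwa [hW, sub_sub_cancel] at this
    rcases hp.dvd_or_dvd h1 with h1 | h1
    · rcases hp.dvd_or_dvd h1 with h1 | h1
      · rcases hp.dvd_or_dvd h1 with h1 | h1
        · refine hq.not_isUnit (isUnit_of_dvd_unit h1 ?_)
          exact isUnit_C.2 (Nat.cast_add_one_ne_zero m).isUnit
        · have hsep : q.Separable := hq.separable
          exact hq.not_isUnit (hsep.isUnit_of_dvd' dvd_rfl h1)
      · exact hA₀ h1
    · exact hB h1
  have key : P ^ i * W = q ^ (m + 2) * (R * A₀ ^ 2) := by
    have hq0 : q ^ m ≠ 0 := pow_ne_zero _ hq.ne_zero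
    apply mul_left_cancel₀ hq0
    have e : q ^ m * (P ^ i * W) =
        P ^ i * (derivative B * (q ^ (m + 1) * A₀) - B * derivative (q ^ (m + 1) * A₀)) := by
      rw [hW, derivative_mul, derivative_pow_succ]
      ring
    rw [e, h]
    ring
  exact hp.pow_dvd_of_dvd_mul_right _ hqW ⟨_, key⟩

/-- Splitting off a greatest common divisor in a Wronskian equation. -/
lemma exists_coprime_wronskian {Q F G R : k[X]} (hF : F ≠ 0)
    (h : Q * (derivative G * F - G * derivative F) = R * F ^ 2) :
    ∃ g A B : k[X], g ≠ 0 ∧ A ≠ 0 ∧ F = g * A ∧ G = g * B ∧ IsCoprime A B ∧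
      Q * (derivative B * A - B * derivative A) = R * A ^ 2 := by
  classical
  have hg : EuclideanDomain.gcd F G ≠ 0 := fun h0 => hF (EuclideanDomain.gcd_eq_zero_iff.1 h0).1
  obtain ⟨A, hA⟩ := EuclideanDomain.gcd_dvd_left F G
  obtain ⟨B, hB⟩ := EuclideanDomain.gcd_dvd_right F G
  set g := EuclideanDomain.gcd F G with hgd
  refine ⟨g, A, B, hg, ?_, hA, hB, ?_, ?_⟩
  · rintro rfl
    exact hF (by rw [hA, mul_zero])
  · refine ⟨EuclideanDomain.gcdA F G, EuclideanDomain.gcdB F G, ?_⟩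
    apply mul_left_cancel₀ hg
    have := EuclideanDomain.gcd_eq_gcd_ab F G
    rw [← hgd] at this
    calc _ = (g * A) * EuclideanDomain.gcdA F G + (g * B) * EuclideanDomain.gcdB F G := by ring
      _ = g * 1 := by rw [← hA, ← hB, ← this, mul_one]
  · apply mul_left_cancel₀ (pow_ne_zero 2 hg)
    rw [hA, hB, derivative_mul, derivative_mul] at h
    linear_combination h

lemma exists_pow_succ_mul_of_dvd {q A : k[X]} (hq : Irreducible q) (hA : A ≠ 0) (h : q ∣ A) :
    ∃ (m : ℕ) (A₀ : k[X]), A = q ^ (m + 1) * A₀ ∧ ¬ q ∣ A₀ := by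
  have hfin : FiniteMultiplicity q A := FiniteMultiplicity.of_not_isUnit hq.not_isUnit hA
  obtain ⟨c, hc, hd⟩ := hfin.exists_eq_pow_mul_and_not_dvd
  have hm : multiplicity q A ≠ 0 := fun h0 => hd (by rwa [hc, h0, pow_zero, one_mul] at h)
  obtain ⟨m, hm⟩ := Nat.exists_eq_succ_of_ne_zero hm
  exact ⟨m, c, by rw [← Nat.succ_eq_add_one, ← hm]; exact hc, hd⟩

/-- If `P` is squarefree and `P * (G / F)'` is a polynomial, then so is `G / F`. -/
lemma dvd_of_wronskian [CharZero k] {P F G R : k[X]} (hP : Squarefree P) (hF : F ≠ 0)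
    (h : P * (derivative G * F - G * derivative F) = R * F ^ 2) : F ∣ G := by
  obtain ⟨g, A, B, -, hA, rfl, rfl, hAB, h⟩ := exists_coprime_wronskian hF h
  suffices IsUnit A from mul_dvd_mul_left g this.dvd
  by_contra hu
  obtain ⟨q, hq, hqA⟩ := WfDvdMonoid.exists_irreducible_factor hu hA
  obtain ⟨m, A₀, rfl, hA₀⟩ := exists_pow_succ_mul_of_dvd hq hA hqA
  have hqB : ¬ q ∣ B := fun hB => hq.not_isUnit (hAB.isUnit_of_dvd' hqA hB)
  rw [← pow_one P] at h
  have := pow_succ_dvd_of_wronskian hq hA₀ hqB h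
  rw [pow_one] at this
  exact hq.not_isUnit (hP q (by rw [← sq]; exact (pow_dvd_pow q (by lia)).trans this))

/-- If `P` is squarefree and `P ^ 2 * (G / F)'` is a polynomial, then so is `P * (G / F)`. -/
lemma dvd_mul_of_wronskian [CharZero k] {P F G R : k[X]} (hP : Squarefree P) (hF : F ≠ 0)
    (h : P ^ 2 * (derivative G * F - G * derivative F) = R * F ^ 2) : F ∣ P * G := by
  obtain ⟨g, A, B, -, hA, rfl, rfl, hAB, h⟩ := exists_coprime_wronskian hF h
  suffices A ∣ P by
    rw [mul_left_comm]
    exact mul_dvd_mul_left g (this.mul_right B)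
  have hsq : Squarefree A := by
    refine (squarefree_iff_no_irreducibles hA).2 fun q hq hqA => ?_
    obtain ⟨m, A₀, rfl, hA₀⟩ := exists_pow_succ_mul_of_dvd hq hA ((dvd_mul_right q q).trans hqA)
    have hm : m ≠ 0 := by
      rintro rfl
      rw [zero_add, pow_one] at hqA
      exact hA₀ ((mul_dvd_mul_iff_left hq.ne_zero).1 hqA)
    have hqB : ¬ q ∣ B := fun hB =>
      hq.not_isUnit (hAB.isUnit_of_dvd' ((dvd_mul_right q q).trans hqA) hB)
    -- A multiple pole of `B / A` gives its derivative a pole of order at least 3, but `P ^ 2`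
    -- absorbs only order 2.
    have h3 : q ^ 3 ∣ P ^ 2 :=
      (pow_dvd_pow q (by lia)).trans (pow_succ_dvd_of_wronskian hq hA₀ hqB h)
    obtain ⟨P₀, rfl⟩ := hq.prime.dvd_of_dvd_pow ((dvd_pow_self q three_ne_zero).trans h3)
    have h4 : q ∣ P₀ ^ 2 := by
      have : q ^ 2 * q ∣ q ^ 2 * P₀ ^ 2 := by rwa [← pow_succ, ← mul_pow]
      exact (mul_dvd_mul_iff_left (pow_ne_zero 2 hq.ne_zero)).1 this
    exact hq.not_isUnit (hP q (mul_dvd_mul_left q (hq.prime.dvd_of_dvd_pow h4)))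
  have hsep : IsCoprime A (derivative A) := PerfectField.separable_iff_squarefree.2 hsq
  have h1 : A ∣ P ^ 2 * B * derivative A :=
    ⟨P ^ 2 * derivative B - R * A, by linear_combination -h⟩
  exact hsq.isRadical 2 P (hAB.dvd_of_dvd_mul_right (hsep.dvd_of_dvd_mul_right h1))

lemma squarefree_C_mul_X_pow_add_C [CharZero k] {s : ℕ} (hs : s ≠ 0) {c₁ c₂ : k}
    (hc₁ : c₁ ≠ 0) (hc₂ : c₂ ≠ 0) :
    Squarefree (C c₁ * X ^ s + C c₂ : k[X]) := by
  have h : (X ^ s - C (-(c₂ / c₁)) : k[X]).Separable :=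
    separable_X_pow_sub_C _ (Nat.cast_ne_zero.2 hs) (neg_ne_zero.2 (div_ne_zero hc₂ hc₁))
  have e : (C c₁ * X ^ s + C c₂ : k[X]) = C c₁ * (X ^ s - C (-(c₂ / c₁))) := by
    rw [mul_sub, ← C_mul, mul_neg, mul_div_cancel₀ c₂ hc₁, C_neg, sub_neg_eq_add]
  rw [e]
  exact (h.unit_mul (isUnit_C.2 hc₁.isUnit)).squarefree

/-- The degree of the coefficients is too small for a nonconstant `h` with `P * h' = M`. -/
lemma eq_zero_of_mul_derivative_eq {P M h : k[X]} (hM : M.degree < P.degree)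
    (e : P * derivative h = M) : M = 0 := by
  by_contra hM0
  rw [← e] at hM hM0
  exact absurd (degree_le_mul_left P (right_ne_zero_of_mul hM0)) (not_le.2 hM)

/-- A polynomial solution `H` of the first order equation below has degree at most `s`. -/
lemma natDegree_le_of_mul_derivative_eq [CharZero k] {s : ℕ} (hs : 1 ≤ s) {c₁ c₂ a b : k}
    (hc₁ : c₁ ≠ 0) {L M H : k[X]} (hL : L.degree < s) (hM : M.degree < s)
    (h : (C c₁ * X ^ s + C c₂) * (derivative H - M + C a) =
      C (s * c₁) * X ^ (s - 1) * H - C b * (X * L)) : H.natDegree ≤ s := by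
  by_contra! hlt
  obtain ⟨m, hm⟩ : ∃ m, H.natDegree = m + 1 := ⟨H.natDegree - 1, by lia⟩
  have hH : H.coeff (m + 1) ≠ 0 := by
    rw [← hm]
    exact leadingCoeff_ne_zero.2 (by rintro rfl; simp at hlt)
  have hMm : ∀ j, s ≤ j → M.coeff j = 0 := fun j hj =>
    coeff_eq_zero_of_degree_lt (hM.trans_le (by exact_mod_cast hj))
  have hLm : ∀ j, s ≤ j → L.coeff j = 0 := fun j hj =>
    coeff_eq_zero_of_degree_lt (hL.trans_le (by exact_mod_cast hj))
  have hHm : ∀ j, m + 1 < j → H.coeff j = 0 := fun j hj =>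
    coeff_eq_zero_of_natDegree_lt (by lia)
  -- In this degree only `c₁ * X ^ s * H'` and `s * c₁ * X ^ (s - 1) * H` contribute, which forces
  -- `m + 1 = s`.
  have e := congrArg (fun p => p.coeff (m + s)) h
  have e1 : m + s = (m + 1) + (s - 1) := by lia
  have e2 : m + s = (m + s - 1) + 1 := by lia
  have e3 : (C a : k[X]).coeff m = 0 := coeff_C_of_ne_zero (by lia)
  have e4 : (C a : k[X]).coeff (m + s) = 0 := coeff_C_of_ne_zero (by lia)
  simp only [add_mul, mul_assoc, coeff_add, coeff_sub, coeff_C_mul, coeff_X_pow_mul,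
    coeff_derivative] at e
  rw [e3, e4, hMm m (by lia), hMm (m + s) (by lia), hHm (m + s + 1) (by lia)] at e
  conv_rhs at e => rw [e2, coeff_X_mul, hLm _ (by lia), ← e2, e1, coeff_X_pow_mul]
  have : c₁ * H.coeff (m + 1) * ((m : k) + 1 - s) = 0 := by linear_combination e
  rcases mul_eq_zero.1 this with h1 | h1
  · exact (mul_ne_zero hc₁ hH) h1
  · have : ((m + 1 : ℕ) : k) = s := by push_cast; linear_combination h1
    have := Nat.cast_injective this
    lia

/-- Comparison of coefficients in the first order equation for `H`. -/
lemma coeff_relation_of_mul_derivative_eq [CharZero k] {s : ℕ} (hs : 1 ≤ s) {c₁ c₂ a b : k}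
    (hc₁ : c₁ ≠ 0) (hc₂ : c₂ ≠ 0) {L M H : k[X]} (hL : L.degree < s) (hM : M.degree < s)
    (hM0 : M.coeff 0 = 0)
    (h : (C c₁ * X ^ s + C c₂) * (derivative H - M + C a) =
      C (s * c₁) * X ^ (s - 1) * H - C b * (X * L)) :
    s * a * c₁ + b * L.coeff (s - 1) = 0 := by
  have hdeg := natDegree_le_of_mul_derivative_eq hs hc₁ hL hM h
  obtain ⟨r, rfl⟩ : ∃ r, s = r + 1 := ⟨s - 1, by lia⟩
  -- Multiplying the equation by `X` turns `P'` into `s * (P - c₂)`, so `P` factors out with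
  -- cofactor `Q`. Degrees `s + 1` and `1` of `key` then determine `Q.coeff 1` in two ways.
  set Q := C ((r : k) + 1) * H - X * (derivative H - M + C a) with hQ
  have key : (C c₁ * X ^ (r + 1) + C c₂) * Q = C (((r : k) + 1) * c₂) * H + C b * (X * (X * L)) := by
    rw [hQ]
    simp only [Nat.add_sub_cancel, Nat.cast_add, Nat.cast_one, C_mul, C_add] at h ⊢
    linear_combination (-X) * h
  have hH : H.coeff (r + 2) = 0 := coeff_eq_zero_of_natDegree_lt (by lia)
  have hMr : M.coeff (r + 1) = 0 := coeff_eq_zero_of_degree_lt (by exact_mod_cast hM)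
  have hQtop : Q.coeff (r + 2) = 0 := by
    rw [hQ]
    simp only [coeff_sub, coeff_C_mul, coeff_X_mul, coeff_add, coeff_derivative, hH, hMr,
      coeff_C_of_ne_zero (Nat.succ_ne_zero r)]
    ring
  have hQ1 : Q.coeff 1 = r * H.coeff 1 - a := by
    have : (X * (derivative H - M + C a)).coeff 1 = (derivative H - M + C a).coeff 0 :=
      coeff_X_mul _ 0
    rw [hQ, coeff_sub, this]
    simp only [coeff_sub, coeff_C_mul, coeff_add, coeff_derivative, hM0, coeff_C_zero]
    push_cast
    ring
  have etop := congrArg (fun p => p.coeff (r + 2)) key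
  have e1 := congrArg (fun p => p.coeff 1) key
  have hX1 : (X * (X * L)).coeff 1 = 0 := by
    rw [show (1 : ℕ) = 0 + 1 from rfl, coeff_X_mul, mul_coeff_zero, coeff_X_zero, zero_mul]
  simp only [add_mul, mul_assoc, coeff_add, coeff_C_mul, coeff_X_mul, hH, hQtop] at etop
  have hXt : (X ^ (r + 1) * Q).coeff (r + 2) = Q.coeff 1 := by
    rw [show r + 2 = 1 + (r + 1) by ring, coeff_X_pow_mul]
  rw [hXt] at etop
  simp only [add_mul, mul_assoc, coeff_add, coeff_C_mul, hX1] at e1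
  simp only [Nat.add_sub_cancel]
  push_cast
  -- For `s = 1` the term `X ^ s * Q` reaches degree 1, but there `Q.coeff 1 = -a` already suffices.
  rcases Nat.eq_zero_or_pos r with rfl | hr
  · rw [hQ1] at etop
    push_cast at etop ⊢
    linear_combination -etop
  · have hz : (X ^ (r + 1) * Q).coeff 1 = 0 := by
      rw [coeff_X_pow_mul', if_neg (by lia)]
    rw [hz] at e1
    have h2 : Q.coeff 1 = ((r : k) + 1) * H.coeff 1 := by
      apply mul_left_cancel₀ hc₂
      linear_combination e1
    linear_combination -etop + c₁ * ((r : k) + 1) * hQ1 - c₁ * r * h2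

/-- The relation forced by the two leading layers of a Darboux polynomial. -/
lemma coeff_relation_of_layers [CharZero k] {s : ℕ} (hs : 1 ≤ s) {c₁ c₂ a b : k}
    (hc₁ : c₁ ≠ 0) (hc₂ : c₂ ≠ 0) {F G L M : k[X]} (hF : F ≠ 0) (hL : L.degree < s)
    (hM : M.degree < s) (hM0 : M.coeff 0 = 0)
    (hFL : (C c₁ * X ^ s + C c₂) * derivative F = L * F)
    (hG : (s : k[X]) * (L * G + M * F) = C a * F + C b * (X * derivative F) +
      (s : k[X]) * ((C c₁ * X ^ s + C c₂) * derivative G)) :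
    s * a * c₁ + b * L.coeff (s - 1) = 0 := by
  set P : k[X] := C c₁ * X ^ s + C c₂ with hP
  have hs0 : (s : k) ≠ 0 := by exact_mod_cast (show s ≠ 0 by lia)
  have hG' : P * derivative G = L * G + M * F - C (a / s) * F - C (b / s) * (X * derivative F) := by
    apply mul_left_cancel₀ (show (s : k[X]) ≠ 0 by exact_mod_cast (show s ≠ 0 by lia))
    have ha : (s : k[X]) * C (a / s) = C a := by
      rw [← C_eq_natCast, ← C_mul, mul_div_cancel₀ a hs0]
    have hb : (s : k[X]) * C (b / s) = C b := by
      rw [← C_eq_natCast, ← C_mul, mul_div_cancel₀ b hs0]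
    linear_combination -hG + F * ha + X * derivative F * hb
  -- The second factor `P` serves to replace `P * F'` by `L * F` in the term coming from `∂_x`.
  have hW : P ^ 2 * (derivative G * F - G * derivative F) =
      (P * (M - C (a / s)) - C (b / s) * (X * L)) * F ^ 2 := by
    linear_combination P * F * hG' - (P * G + C (b / s) * X * F) * hFL
  obtain ⟨H, hH⟩ := dvd_mul_of_wronskian (squarefree_C_mul_X_pow_add_C (by lia) hc₁ hc₂) hF hW
  have hdP : derivative P = C (s * c₁) * X ^ (s - 1) := by
    rw [hP]
    simp only [derivative_add, derivative_C_mul, derivative_X_pow, derivative_C, add_zero, C_mul]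
    ring
  have hdH := congrArg derivative hH
  rw [derivative_mul, derivative_mul, hdP] at hdH
  have := coeff_relation_of_mul_derivative_eq (a := a / s) (b := b / s) (H := H) hs hc₁ hc₂ hL hM
    hM0 (by
      rw [← hP]
      apply mul_right_cancel₀ hF
      linear_combination -P * hdH + P * hG' - (H + C (b / s) * X) * hFL +
        (C (s * c₁) * X ^ (s - 1) + L) * hH)
  have e : (s : k) * (a / s) = a := mul_div_cancel₀ a hs0
  have e' : (s : k) * (b / s) = b := mul_div_cancel₀ b hs0
  linear_combination s * this - s * c₁ * e - L.coeff (s - 1) * e'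

end OneVariable

/-! ### The weight grading and the derivation on layers -/

section Layers

open Polynomial

variable {k : Type*} [Field k]

/-- The partial derivative of `k[x][y]` with respect to `x`. -/
noncomputable def coeffDeriv (p : k[X][X]) : k[X][X] :=
  PolynomialModule.equivPolynomialSelf (derivative'.mapCoeffs p)

lemma coeff_coeffDeriv (p : k[X][X]) (j : ℕ) :
    (coeffDeriv p).coeff j = derivative (p.coeff j) := by
  rfl

lemma coeffDeriv_add (p q : k[X][X]) : coeffDeriv (p + q) = coeffDeriv p + coeffDeriv q := by
  simp [coeffDeriv]

lemma coeffDeriv_C_mul (c : k[X]) (p : k[X][X]) :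
    coeffDeriv (C c * p) = C (derivative c) * p + C c * coeffDeriv p := by
  ext1 j
  simp [coeff_coeffDeriv, derivative_mul]

lemma coeffDeriv_monomial (j : ℕ) (a : k[X]) :
    coeffDeriv (monomial j a) = monomial j (derivative a) := by
  ext1 i
  rw [coeff_coeffDeriv, coeff_monomial, coeff_monomial]
  split_ifs <;> simp

/-- The vector field `x ^ u * (c₁ * x ^ t * y ^ s + c₂)`. -/
noncomputable def yField (s t u : ℕ) (c₁ c₂ : k) : k[X][X] :=
  C (C c₁ * X ^ (u + t)) * X ^ s + C (C c₂ * X ^ u)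

/-- The derivation `∂_x + x ^ u * (c₁ * x ^ t * y ^ s + c₂) ∂_y` on `k[x][y]`. -/
noncomputable def yFlow (s t u : ℕ) (c₁ c₂ : k) (p : k[X][X]) : k[X][X] :=
  coeffDeriv p + yField s t u c₁ c₂ * derivative p

lemma yFlow_add (s t u : ℕ) (c₁ c₂ : k) (p q : k[X][X]) :
    yFlow s t u c₁ c₂ (p + q) = yFlow s t u c₁ c₂ p + yFlow s t u c₁ c₂ q := by
  simp only [yFlow, coeffDeriv_add, derivative_add]
  ring

/-- The substitution `x = T ^ (-s)`, `y = v * T ^ t`, with `v` the variable of the coefficients. -/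
noncomputable def layerHom (s t : ℕ) : k[X][X] →+* LaurentPolynomial k[X] :=
  eval₂RingHom (eval₂RingHom (LaurentPolynomial.C.comp C) (LaurentPolynomial.T (-s)))
    (LaurentPolynomial.C X * LaurentPolynomial.T t)

lemma layerHom_monomial (s t i j : ℕ) (a : k) :
    layerHom s t (monomial j (monomial i a)) =
      LaurentPolynomial.C (monomial j a) * LaurentPolynomial.T (t * j - s * i) := by
  rw [layerHom, coe_eval₂RingHom, eval₂_monomial, coe_eval₂RingHom, eval₂_monomial, mul_pow,
    LaurentPolynomial.T_pow, LaurentPolynomial.T_pow, RingHom.comp_apply,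
    ← C_mul_X_pow_eq_monomial, map_mul, map_pow]
  rw [show (t * j - s * i : ℤ) = i * (-s) + j * t by ring, LaurentPolynomial.T_add]
  ring

lemma coeff_layerHom_monomial (s t i j : ℕ) (a : k) (w : ℤ) :
    (layerHom s t (monomial j (monomial i a))).coeff w =
      if (t * j - s * i : ℤ) = w then monomial j a else 0 := by
  rw [layerHom_monomial, ← LaurentPolynomial.single_eq_C_mul_T]
  rw [AddMonoidAlgebra.coeff_single, Finsupp.single_apply]

/-- Induction on bivariate polynomials through monomials. -/
lemma bivariate_induction {motive : k[X][X] → Prop}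
    (add : ∀ p q, motive p → motive q → motive (p + q))
    (mono : ∀ i j a, motive (monomial j (monomial i a))) (p : k[X][X]) : motive p := by
  induction p using Polynomial.induction_on' with
  | add p q hp hq => exact add p q hp hq
  | monomial j a =>
    induction a using Polynomial.induction_on' with
    | add a b ha hb => rw [map_add]; exact add _ _ ha hb
    | monomial i a => exact mono i j a

/-- Since `s ≠ 0`, the weight and the exponent of `y` determine the exponent of `x`, so no two
monomials collide. -/
lemma coeff_coeff_layerHom {s t : ℕ} (hs : s ≠ 0) (p : k[X][X]) (i j : ℕ) :
    ((layerHom s t p).coeff (t * j - s * i)).coeff j = (p.coeff j).coeff i := by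
  induction p using bivariate_induction with
  | add p q hp hq => simp [hp, hq]
  | mono i' j' a =>
    rw [coeff_layerHom_monomial, coeff_monomial]
    by_cases hj : j' = j
    · subst hj
      rw [if_pos rfl, coeff_monomial]
      have : (t * j' - s * i' : ℤ) = t * j' - s * i ↔ i' = i := by
        rw [sub_right_inj, mul_right_inj' (by exact_mod_cast hs), Nat.cast_inj]
      simp only [this]
      split_ifs <;> simp
    · rw [if_neg hj]
      split_ifs <;> simp [coeff_monomial, hj]

lemma exists_of_coeff_coeff_layerHom_ne_zero {s t : ℕ} (p : k[X][X]) {w : ℤ} {j : ℕ}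
    (h : ((layerHom s t p).coeff w).coeff j ≠ 0) : ∃ i : ℕ, w = t * j - s * i := by
  contrapose! h
  induction p using bivariate_induction with
  | add p q hp hq => simp [hp, hq]
  | mono i' j' a =>
    rw [coeff_layerHom_monomial]
    split_ifs with hw
    · rw [coeff_monomial]
      split_ifs with hj
      · subst hj
        exact absurd hw.symm (h i')
      · rfl
    · rfl

lemma layerHom_injective {s t : ℕ} (hs : s ≠ 0) :
    Function.Injective (layerHom (k := k) s t) := by
  rw [injective_iff_map_eq_zero]
  intro p hp
  ext j i
  rw [← coeff_coeff_layerHom hs, hp]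
  simp

lemma yFlow_monomial (s t u i j : ℕ) (c₁ c₂ a : k) :
    yFlow s t u c₁ c₂ (monomial j (monomial i a)) = monomial j (monomial (i - 1) (a * i)) +
      (monomial (j - 1 + s) (monomial (i + (u + t)) (c₁ * (a * j))) +
      monomial (j - 1) (monomial (i + u) (c₂ * (a * j)))) := by
  have hj : (monomial i a : k[X]) * (j : k[X]) = monomial i (a * j) := by
    rw [← C_eq_natCast, mul_comm, C_mul_monomial, mul_comm]
  rw [yFlow, coeffDeriv_monomial, derivative_monomial, derivative_monomial, yField, add_mul, hj,
    C_mul_X_pow_eq_monomial, C_mul_X_pow_eq_monomial, C_mul_X_pow_eq_monomial, monomial_mul_monomial,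
    monomial_mul_monomial, C_mul_monomial, monomial_mul_monomial, add_comm s, add_comm (u + t),
    add_comm u i]

/-- The derivation in the coordinates `T`, `v`. -/
lemma coeff_layerHom_yFlow (s t u : ℕ) (c₁ c₂ : k) (p : k[X][X]) (w : ℤ) :
    (s : k[X]) * (layerHom s t (yFlow s t u c₁ c₂ p)).coeff (w + s) =
      -(w : k[X]) * (layerHom s t p).coeff w +
      (t : k[X]) * (X * derivative ((layerHom s t p).coeff w)) +
      (s : k[X]) * ((C c₁ * X ^ s + C c₂) *
        derivative ((layerHom s t p).coeff (w + (s + t + s * u)))) := by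
  induction p using bivariate_induction with
  | add p q hp hq =>
    simp only [yFlow_add, map_add, AddMonoidAlgebra.coeff_add, Finsupp.add_apply, mul_add, hp, hq]
    ring
  | mono i j a =>
    simp only [yFlow_monomial, map_add, AddMonoidAlgebra.coeff_add, Finsupp.add_apply,
      coeff_layerHom_monomial]
    have e1 : (s : k[X]) * (if (t * j - s * (i - 1 : ℕ) : ℤ) = w + s then
          monomial j (a * (i : k)) else 0) =
        if (t * j - s * i : ℤ) = w then (s : k[X]) * ((i : k[X]) * monomial j a) else 0 := by
      rw [mul_comm a, ← C_mul_monomial, C_eq_natCast]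
      rcases i with _ | i
      · simp
      · have : (t * j - s * (i + 1 - 1 : ℕ) : ℤ) = w + s ↔
            (t * j - s * (i + 1 : ℕ) : ℤ) = w := by
          rw [Nat.add_sub_cancel]
          push_cast
          constructor <;> intro h <;> linear_combination h
        simp only [this, mul_ite, mul_zero]
    have e2 : (if (t * (j - 1 + s : ℕ) - s * (i + (u + t) : ℕ) : ℤ) = w + s then
          monomial (j - 1 + s) (c₁ * (a * (j : k))) else 0) +
          (if (t * (j - 1 : ℕ) - s * (i + u : ℕ) : ℤ) = w + s then
          monomial (j - 1) (c₂ * (a * (j : k))) else 0) =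
        (C c₁ * X ^ s + C c₂) * derivative
          (if (t * j - s * i : ℤ) = w + (s + t + s * u) then monomial j a else 0) := by
      rcases j with _ | j
      · split_ifs <;> simp
      · have h1 : (t * (j + 1 - 1 + s : ℕ) - s * (i + (u + t) : ℕ) : ℤ) = w + s ↔
            (t * (j + 1 : ℕ) - s * i : ℤ) = w + (s + t + s * u) := by
          rw [Nat.add_sub_cancel]
          push_cast
          constructor <;> intro h <;> linear_combination h
        have h2 : (t * (j + 1 - 1 : ℕ) - s * (i + u : ℕ) : ℤ) = w + s ↔
            (t * (j + 1 : ℕ) - s * i : ℤ) = w + (s + t + s * u) := by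
          rw [Nat.add_sub_cancel]
          push_cast
          constructor <;> intro h <;> linear_combination h
        simp only [h1, h2]
        split_ifs
        · rw [derivative_monomial, add_mul, C_mul_X_pow_eq_monomial, monomial_mul_monomial,
            C_mul_monomial, add_comm s]
        · simp
    rw [mul_add, e1, e2]
    congr 1
    split_ifs with hw
    · have hd : (X : k[X]) * derivative (monomial j a) = (j : k[X]) * monomial j a := by
        rw [derivative_monomial, mul_comm a, ← C_mul_monomial, C_eq_natCast]
        rcases j with _ | j
        · simp
        · rw [Nat.add_sub_cancel, mul_left_comm, X_mul_monomial]
      rw [hd, ← hw]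
      push_cast
      ring
    · simp

end Layers

/-! ### Darboux polynomials and their cofactors -/

section Darboux

open Polynomial

variable {k : Type*} [Field k]

lemma natDegree_coeffDeriv_le (p : k[X][X]) : (coeffDeriv p).natDegree ≤ p.natDegree := by
  rw [natDegree_le_iff_coeff_eq_zero]
  intro j hj
  rw [coeff_coeffDeriv, coeff_eq_zero_of_natDegree_lt hj, derivative_zero]

lemma natDegree_yField_le (s t u : ℕ) (c₁ c₂ : k) : (yField s t u c₁ c₂).natDegree ≤ s := by
  unfold yField
  compute_degree

lemma coeff_yField {s : ℕ} (hs : 1 ≤ s) (t u : ℕ) (c₁ c₂ : k) :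
    (yField s t u c₁ c₂).coeff s = C c₁ * X ^ (u + t) := by
  rw [yField, coeff_add, coeff_C_mul_X_pow, if_pos rfl, coeff_C_of_ne_zero (by lia), add_zero]

lemma natDegree_cofactor_le {s t u n : ℕ} {c₁ c₂ : k} {f l : k[X][X]} (hs : 1 ≤ s)
    (hn : f.natDegree = n + 1) (h : yFlow s t u c₁ c₂ f = l * f) : l.natDegree ≤ s - 1 := by
  rcases eq_or_ne l 0 with rfl | hl
  · simp
  have hf : f ≠ 0 := by rintro rfl; simp at hn
  have h1 : (yFlow s t u c₁ c₂ f).natDegree ≤ s + n := by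
    refine (natDegree_add_le_of_le (n := s + n) ((natDegree_coeffDeriv_le f).trans (by lia)) ?_).trans
      (max_self _).le
    exact natDegree_mul_le_of_le (natDegree_yField_le ..)
      ((natDegree_derivative_le f).trans (by lia))
  rw [h, natDegree_mul hl hf] at h1
  lia

/-- Compare coefficients of `y ^ (s + n)`. For `s > 1` the `∂_x` term has too low a degree in `y`;
for `s = 1` it contributes the derivative of the leading coefficient, which is a multiple of that
coefficient only if it vanishes. -/
lemma coeff_cofactor [CharZero k] {s t u n : ℕ} {c₁ c₂ : k} {f l : k[X][X]} (hs : 1 ≤ s)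
    (hn : f.natDegree = n + 1) (h : yFlow s t u c₁ c₂ f = l * f) :
    l.coeff (s - 1) = C ((n + 1 : ℕ) * c₁) * X ^ (u + t) := by
  have hl := natDegree_cofactor_le hs hn h
  have ha : f.coeff (n + 1) ≠ 0 := by
    rw [← hn]
    exact leadingCoeff_ne_zero.2 (by rintro rfl; simp at hn)
  have e := congrArg (fun p => p.coeff (s + n)) h
  have e1 : (l * f).coeff (s + n) = l.coeff (s - 1) * f.coeff (n + 1) := by
    rw [show s + n = (s - 1) + (n + 1) by lia]
    exact coeff_mul_add_eq_of_natDegree_le hl hn.le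
  have e2 : (yField s t u c₁ c₂ * derivative f).coeff (s + n) =
      C c₁ * X ^ (u + t) * (f.coeff (n + 1) * ((n : k[X]) + 1)) := by
    rw [coeff_mul_add_eq_of_natDegree_le (natDegree_yField_le ..)
      ((natDegree_derivative_le f).trans (by lia : f.natDegree - 1 ≤ n)), coeff_yField hs,
      coeff_derivative]
  simp only [yFlow, coeff_add, coeff_coeffDeriv, e1, e2] at e
  rcases Nat.lt_or_ge 1 s with hs1 | hs1
  · rw [coeff_eq_zero_of_natDegree_lt (show f.natDegree < s + n by lia), derivative_zero,
      zero_add] at e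
    apply mul_right_cancel₀ ha
    rw [← e, C_mul, C_eq_natCast]
    push_cast
    ring
  · obtain rfl : s = 1 := le_antisymm hs1 hs
    rw [add_comm 1 n] at e
    have h0 : derivative (f.coeff (n + 1)) =
        (l.coeff (1 - 1) - C ((n + 1 : ℕ) * c₁) * X ^ (u + t)) * f.coeff (n + 1) := by
      rw [C_mul, C_eq_natCast]
      push_cast
      linear_combination e
    by_contra hne
    have hne' := sub_ne_zero.2 hne
    have hlt := degree_derivative_lt ha
    rw [h0] at hlt
    exact absurd (degree_le_mul_left _ hne') (by rw [mul_comm]; exact not_le.2 hlt)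

open LaurentPolynomial in
lemma exists_eq_T_mul_toLaurent {R : Type*} [CommRing R] [IsDomain R] {a : LaurentPolynomial R}
    (ha : a ≠ 0) : ∃ (n : ℤ) (G : R[X]), G.coeff 0 ≠ 0 ∧ a = T n * toLaurent G := by
  obtain ⟨m, p, hp⟩ := exists_T_pow a
  have hp0 : p ≠ 0 := by
    rintro rfl
    rw [map_zero] at hp
    exact ha ((isUnit_T (R := R) m).mul_left_eq_zero.1 hp.symm)
  obtain ⟨G, hG, hX⟩ := exists_eq_pow_rootMultiplicity_mul_and_not_dvd p hp0 0
  rw [C_0, sub_zero] at hG hX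
  refine ⟨rootMultiplicity 0 p - m, G, fun h => hX (X_dvd_iff.2 h), ?_⟩
  have : a = a * T m * T (-m) := by rw [mul_T_assoc, add_neg_cancel, T_zero, mul_one]
  rw [this, ← hp, T_sub]
  conv_lhs => rw [hG]
  rw [map_mul, toLaurent_X_pow]
  ring

open LaurentPolynomial in
lemma coeff_T_mul {R : Type*} [CommRing R] (a : LaurentPolynomial R) (n w : ℤ) :
    (T n * a).coeff (n + w) = a.coeff w := by
  induction a using LaurentPolynomial.induction_on' with
  | add p q hp hq => rw [mul_add, AddMonoidAlgebra.coeff_add, Finsupp.add_apply, hp, hq]; rfl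
  | C_mul_T m r =>
    rw [mul_left_comm, ← T_add, ← single_eq_C_mul_T, ← single_eq_C_mul_T,
      AddMonoidAlgebra.coeff_single, AddMonoidAlgebra.coeff_single, Finsupp.single_apply,
      Finsupp.single_apply]
    simp only [add_right_inj]

open LaurentPolynomial in
lemma coeff_T_mul_toLaurent {R : Type*} [CommRing R] (G : R[X]) (n : ℤ) (e : ℕ) :
    (T n * toLaurent G).coeff (n + e) = G.coeff e := by
  rw [coeff_T_mul, coeff_toLaurent]
  exact Finsupp.mapDomain_apply Nat.cast_injective _ _

open LaurentPolynomial in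
lemma coeff_T_mul_toLaurent_of_lt {R : Type*} [CommRing R] (G : R[X]) {n w : ℤ} (h : w < n) :
    (T n * toLaurent G).coeff w = 0 := by
  rw [← add_sub_cancel n w, coeff_T_mul, coeff_toLaurent]
  apply Finsupp.mapDomain_of_notMem_range
  rintro ⟨m, hm⟩
  rw [Nat.castEmbedding_apply] at hm
  lia

open LaurentPolynomial in
/-- The layers of a cofactor start at the weight of the dominant part of the derivation. -/
lemma exists_layerHom_cofactor_eq [CharZero k] {s t u : ℕ} {c₁ c₂ : k} {f l : k[X][X]}
    (hs : 1 ≤ s) (h : yFlow s t u c₁ c₂ f = l * f) {n : ℤ} {G : k[X][X]} (hG : G.coeff 0 ≠ 0)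
    (hf : layerHom s t f = T n * toLaurent G) :
    ∃ M : k[X][X], layerHom s t l = T (-(s * u + t)) * toLaurent M := by
  rcases eq_or_ne l 0 with rfl | hl
  · exact ⟨0, by simp⟩
  have hl' : layerHom s t l ≠ 0 := fun h0 =>
    hl (layerHom_injective (t := t) (show s ≠ 0 by lia) (by rw [h0, map_zero]))
  obtain ⟨m, M, hM, hlM⟩ := exists_eq_T_mul_toLaurent hl'
  have hm : (-(s * u + t) : ℤ) ≤ m := by
    -- Otherwise the product of the lowest layers of `l` and `f`, nonzero in a domain, has a weight
    -- that the derivation of `f` cannot reach.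
    by_contra! hlt
    have e := coeff_layerHom_yFlow s t u c₁ c₂ f (m + n - s)
    have e1 : (layerHom s t (yFlow s t u c₁ c₂ f)).coeff (m + n - s + s) =
        M.coeff 0 * G.coeff 0 := by
      rw [h, map_mul, hf, hlM, mul_mul_mul_comm, ← T_add, ← map_mul, ← mul_coeff_zero,
        ← coeff_T_mul_toLaurent (M * G) (m + n) 0]
      congr 1
      simp
    rw [e1, hf, coeff_T_mul_toLaurent_of_lt G (by lia), coeff_T_mul_toLaurent_of_lt G (by lia)] at e
    simp only [derivative_zero, mul_zero, add_zero] at e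
    refine mul_ne_zero ?_ (mul_ne_zero hM hG) e
    exact_mod_cast (show s ≠ 0 by lia)
  obtain ⟨r, hr⟩ := Int.eq_ofNat_of_zero_le (sub_nonneg.2 hm)
  refine ⟨X ^ r * M, ?_⟩
  rw [hlM, map_mul, toLaurent_X_pow, ← mul_assoc, ← T_add]
  congr 2
  lia

/-- A zero of order `m + 1` at the origin would leave `P * F'` with order exactly `m`, while `L * F`
has order at least `m + 1`. -/
lemma coeff_ne_zero_of_mul_derivative_eq [CharZero k] {P F L : k[X]} (hP : P.coeff 0 ≠ 0)
    (hF : F ≠ 0) (h : P * derivative F = L * F) : F.coeff 0 ≠ 0 := by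
  intro h0
  obtain ⟨m, A, rfl, hA⟩ := exists_pow_succ_mul_of_dvd irreducible_X hF (X_dvd_iff.2 h0)
  have hX : (X : k[X]) ∣ P * (C ((m : k) + 1) * A) := by
    refine ⟨L * A - P * derivative A, ?_⟩
    apply mul_left_cancel₀ (pow_ne_zero m (X_ne_zero (R := k)))
    rw [derivative_mul, derivative_X_pow_succ] at h
    linear_combination h
  rw [X_dvd_iff, mul_coeff_zero, mul_coeff_zero, coeff_C_zero] at hX
  exact mul_ne_zero hP (mul_ne_zero (Nat.cast_add_one_ne_zero m) (fun h => hA (X_dvd_iff.2 h))) hX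

lemma coeff_mul_eq_of_coeff_eq_zero {R : Type*} [CommRing R] {M G : R[X]} {e : ℕ} (he : 0 < e)
    (h : ∀ i, 0 < i → i < e → M.coeff i = 0) :
    (M * G).coeff e = M.coeff 0 * G.coeff e + M.coeff e * G.coeff 0 := by
  rw [coeff_mul]
  refine Finset.sum_eq_add_of_mem (0, e) (e, 0) (by simp) (by simp) (by simp; lia) ?_
  rintro ⟨i, j⟩ hij ⟨h1, h2⟩
  rw [Finset.HasAntidiagonal.mem_antidiagonal] at hij
  simp only [ne_eq, Prod.mk.injEq, not_and] at h1 h2 hij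
  rw [h i (by lia) (by lia), zero_mul]

/-- The layers of the cofactor strictly between the first one and the weight `δ` vanish. -/
lemma coeff_cofactor_eq_zero [CharZero k] {P : k[X]} (hP : Squarefree P) {G M : k[X][X]} {d : ℕ}
    (hG : G.coeff 0 ≠ 0) (hM : ∀ e, (M.coeff e).degree < P.degree)
    (h : ∀ e < d, P * derivative (G.coeff e) = (M * G).coeff e) :
    ∀ e, 0 < e → e < d → M.coeff e = 0 := by
  intro e
  induction e using Nat.strong_induction_on with
  | _ e ih =>
    intro he hed
    have h0 := h 0 (by lia)
    rw [mul_coeff_zero] at h0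
    have he' := h e hed
    have hsum := coeff_mul_eq_of_coeff_eq_zero (G := G) he fun i hi hie => ih i hie hi (by lia)
    rw [hsum] at he'
    have hW : P * (derivative (G.coeff e) * G.coeff 0 - G.coeff e * derivative (G.coeff 0)) =
        M.coeff e * G.coeff 0 ^ 2 := by
      linear_combination G.coeff 0 * he' - G.coeff e * h0
    obtain ⟨q, hq⟩ := dvd_of_wronskian hP hG hW
    refine eq_zero_of_mul_derivative_eq (h := q) (hM e) ?_
    apply mul_right_cancel₀ (pow_ne_zero 2 hG)
    rw [← hW, hq, derivative_mul]
    ring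

open LaurentPolynomial hiding C in
/-- Every Darboux polynomial of the derivation has degree zero in `y`. -/
theorem natDegree_eq_zero_of_yFlow_eq_mul [CharZero k] {s t u : ℕ} {c₁ c₂ : k} {f l : k[X][X]}
    (hs : 1 ≤ s) (ht : 1 ≤ t) (hc₁ : c₁ ≠ 0) (hc₂ : c₂ ≠ 0)
    (h : yFlow s t u c₁ c₂ f = l * f) : f.natDegree = 0 := by
  by_contra hdeg
  obtain ⟨n, hn⟩ := Nat.exists_eq_succ_of_ne_zero hdeg
  rw [Nat.succ_eq_add_one] at hn
  have hs0 : s ≠ 0 := by lia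
  have hsk : (s : k[X]) ≠ 0 := by exact_mod_cast hs0
  have hf' : layerHom s t f ≠ 0 := fun h0 => by
    have : f = 0 := layerHom_injective (t := t) hs0 (by rw [h0, map_zero])
    simp [this] at hn
  obtain ⟨n₀, G, hG, hfG⟩ := exists_eq_T_mul_toLaurent hf'
  obtain ⟨M, hlM⟩ := exists_layerHom_cofactor_eq hs h hG hfG
  set P : k[X] := C c₁ * X ^ s + C c₂ with hP
  have hPdeg : P.degree = s := by
    rw [hP, degree_add_C (by rw [degree_C_mul_X_pow _ hc₁]; exact_mod_cast hs),
      degree_C_mul_X_pow _ hc₁]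
  have hP0 : P.coeff 0 ≠ 0 := by simpa [hP, coeff_X_pow, hs0.symm] using hc₂
  set d := s + t + s * u with hd
  have hMc : ∀ e : ℕ, M.coeff e = (layerHom s t l).coeff (-(s * u + t) + e) := fun e => by
    rw [hlM, coeff_T_mul_toLaurent]
  have hflow : layerHom s t (yFlow s t u c₁ c₂ f) = T (n₀ - (s * u + t)) * toLaurent (M * G) := by
    rw [h, map_mul, hlM, hfG, mul_mul_mul_comm, ← T_add, ← map_mul]
    congr 2
    ring
  have hMdeg : ∀ e, (M.coeff e).degree < s := fun e => by
    rw [degree_lt_iff_coeff_zero]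
    intro j hj
    by_contra hne
    rw [hMc] at hne
    obtain ⟨i, hi⟩ := exists_of_coeff_coeff_layerHom_ne_zero l hne
    rw [hi, coeff_coeff_layerHom hs0, coeff_eq_zero_of_natDegree_lt
      ((natDegree_cofactor_le hs hn h).trans_lt (by lia)), coeff_zero] at hne
    exact hne rfl
  have hlow : ∀ e < d, P * derivative (G.coeff e) = (M * G).coeff e := fun e he => by
    have e1 := coeff_layerHom_yFlow s t u c₁ c₂ f (n₀ - d + e)
    rw [hflow, hfG, coeff_T_mul_toLaurent_of_lt G (w := n₀ - d + e) (by lia),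
      show (n₀ - d + e + s : ℤ) = n₀ - (s * u + t) + e by rw [hd]; push_cast; ring,
      show (n₀ - d + e + (s + t + s * u) : ℤ) = n₀ + e by rw [hd]; push_cast; ring,
      coeff_T_mul_toLaurent, coeff_T_mul_toLaurent] at e1
    simp only [derivative_zero, mul_zero, zero_add] at e1
    exact (mul_left_cancel₀ hsk e1).symm
  have hMz := coeff_cofactor_eq_zero (squarefree_C_mul_X_pow_add_C hs0 hc₁ hc₂) hG
    (fun e => by rw [← hP, hPdeg]; exact hMdeg e) hlow
  have hsum := coeff_mul_eq_of_coeff_eq_zero (G := G) (show 0 < d by lia) hMz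
  have h0 : P * derivative (G.coeff 0) = M.coeff 0 * G.coeff 0 := by
    rw [hlow 0 (by lia), mul_coeff_zero]
  have e2 : (T n₀ * toLaurent G).coeff n₀ = G.coeff 0 := by
    simpa using coeff_T_mul_toLaurent G n₀ 0
  have htop : (s : k[X]) * (M.coeff 0 * G.coeff d + M.coeff d * G.coeff 0) =
      C (-n₀ : k) * G.coeff 0 + C (t : k) * (X * derivative (G.coeff 0)) +
      (s : k[X]) * (P * derivative (G.coeff d)) := by
    have e1 := coeff_layerHom_yFlow s t u c₁ c₂ f n₀
    rw [hflow, hfG, e2, show (n₀ + s : ℤ) = n₀ - (s * u + t) + d by rw [hd]; push_cast; ring,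
      show (n₀ + (s + t + s * u) : ℤ) = n₀ + d by rw [hd]; push_cast; ring,
      coeff_T_mul_toLaurent, coeff_T_mul_toLaurent, hsum] at e1
    rw [e1, C_neg, C_eq_intCast, C_eq_natCast]
  -- This layer of `l` has weight `s > 0`, whereas a pure power of `x` has weight at most `0`.
  have hMd : (M.coeff d).coeff 0 = 0 := by
    by_contra hne
    rw [hMc] at hne
    obtain ⟨i, hi⟩ := exists_of_coeff_coeff_layerHom_ne_zero l hne
    have : (s : ℤ) * (1 + i) = 0 := by
      rw [hd] at hi
      push_cast at hi
      linear_combination hi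
    rcases mul_eq_zero.1 this with h1 | h1 <;> lia
  have hMtop : (M.coeff 0).coeff (s - 1) = (n + 1 : ℕ) * c₁ := by
    rw [hMc, show (-(s * u + t) + (0 : ℕ) : ℤ) = t * (s - 1 : ℕ) - s * (u + t : ℕ) by
      push_cast [hs]; ring, coeff_coeff_layerHom hs0, coeff_cofactor hs hn h, coeff_C_mul_X_pow,
      if_pos rfl]
  obtain ⟨i, hi⟩ : ∃ i : ℕ, n₀ = t * (0 : ℕ) - s * i := by
    refine exists_of_coeff_coeff_layerHom_ne_zero f (j := 0) ?_
    have := coeff_ne_zero_of_mul_derivative_eq hP0 hG h0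
    rwa [hfG, e2]
  have key := coeff_relation_of_layers hs hc₁ hc₂ hG (hMdeg 0) (hMdeg d) hMd h0 htop
  rw [hMtop, hi] at key
  have key' : ((s * (s * i) + t * (n + 1) : ℕ) : k) = 0 := by
    apply mul_right_cancel₀ hc₁
    push_cast at key ⊢
    linear_combination key
  have := Nat.cast_eq_zero.1 key'
  have : 0 < t * (n + 1) := by positivity
  lia

end Darboux

/-! ### From differential ideals to Darboux polynomials -/

section Ideals

open Polynomial

variable {k : Type*} [Field k]

/-- Pseudo-division by an element of minimal degree of an ideal. -/
lemma exists_dvd_C_mul_of_mem {R : Type*} [CommRing R] [IsDomain R] {I : Ideal R[X]} {f : R[X]}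
    (hf : f ∈ I) (hf0 : f ≠ 0) (hmin : ∀ g ∈ I, g ≠ 0 → f.natDegree ≤ g.natDegree) :
    ∀ g ∈ I, ∃ a : R, a ≠ 0 ∧ f ∣ C a * g := by
  suffices ∀ (n : ℕ), ∀ g ∈ I, g.natDegree < n → ∃ a : R, a ≠ 0 ∧ f ∣ C a * g from
    fun g hg => this _ g hg (Nat.lt_succ_self _)
  intro n
  induction n with
  | zero => exact fun g _ hg => absurd hg (Nat.not_lt_zero _)
  | succ n ih =>
    intro g hg hgn
    rcases eq_or_ne g 0 with rfl | hg0
    · exact ⟨1, one_ne_zero, by simp⟩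
    have hle := hmin g hg hg0
    set r := C f.leadingCoeff * g - C g.leadingCoeff * X ^ (g.natDegree - f.natDegree) * f with hr
    have hrI : r ∈ I := I.sub_mem (I.mul_mem_left _ hg) (I.mul_mem_left _ hf)
    suffices ∃ a : R, a ≠ 0 ∧ f ∣ C a * r by
      obtain ⟨a, ha, q, hq⟩ := this
      refine ⟨a * f.leadingCoeff, mul_ne_zero ha (leadingCoeff_ne_zero.2 hf0),
        q + C (a * g.leadingCoeff) * X ^ (g.natDegree - f.natDegree), ?_⟩
      rw [hr] at hq
      simp only [C_mul]
      linear_combination hq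
    rcases eq_or_ne r 0 with hr0 | hr0
    · exact ⟨1, one_ne_zero, by simp [hr0]⟩
    refine ih r hrI ?_
    have hrdeg : r.degree < g.degree := by
      have hd : (C f.leadingCoeff * g).degree =
          (C g.leadingCoeff * X ^ (g.natDegree - f.natDegree) * f).degree := by
        rw [degree_C_mul (leadingCoeff_ne_zero.2 hf0), degree_mul,
          degree_C_mul_X_pow _ (leadingCoeff_ne_zero.2 hg0), degree_eq_natDegree hg0,
          degree_eq_natDegree hf0, ← Nat.cast_add, Nat.sub_add_cancel hle]
      have := degree_sub_lt_left hd
        (mul_ne_zero (C_ne_zero.2 (leadingCoeff_ne_zero.2 hf0)) hg0) (by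
          rw [leadingCoeff_mul, leadingCoeff_mul, leadingCoeff_mul, leadingCoeff_C, leadingCoeff_C,
            leadingCoeff_X_pow, mul_one, mul_comm])
      rwa [degree_C_mul (leadingCoeff_ne_zero.2 hf0)] at this
    have := natDegree_lt_natDegree hr0 hrdeg
    lia

/-- An ideal of `k[x][y]` containing a nonzero polynomial in `x` and closed under the derivation
is the whole ring. -/
lemma eq_top_of_C_mem [CharZero k] {s t u : ℕ} {c₁ c₂ : k} {I : Ideal k[X][X]}
    (hI : ∀ f ∈ I, yFlow s t u c₁ c₂ f ∈ I) :
    ∀ (n : ℕ) (a : k[X]), a.natDegree = n → a ≠ 0 → C a ∈ I → I = ⊤ := by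
  intro n
  induction n with
  | zero =>
    intro a ha ha0 haI
    obtain ⟨b, rfl⟩ := natDegree_eq_zero.1 ha
    exact I.eq_top_of_isUnit_mem haI (isUnit_C.2 (isUnit_C.2 (C_ne_zero.1 ha0).isUnit))
  | succ n ih =>
    intro a ha ha0 haI
    have hd : (derivative a).natDegree = n := by rw [natDegree_derivative, ha]; rfl
    refine ih (derivative a) hd ?_ ?_
    · intro h0
      have := derivative_eq_zero.1 h0
      lia
    · have h := hI _ haI
      rwa [yFlow, derivative_C, mul_zero, add_zero, ← monomial_zero_left, coeffDeriv_monomial,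
        monomial_zero_left] at h

theorem eq_bot_or_eq_top_of_yFlow_mem [CharZero k] {s t u : ℕ} {c₁ c₂ : k} (hs : 1 ≤ s)
    (ht : 1 ≤ t) (hc₁ : c₁ ≠ 0) (hc₂ : c₂ ≠ 0) {I : Ideal k[X][X]}
    (hI : ∀ f ∈ I, yFlow s t u c₁ c₂ f ∈ I) : I = ⊥ ∨ I = ⊤ := by
  classical
  rw [or_iff_not_imp_left]
  intro hbot
  obtain ⟨f, ⟨hf, hf0⟩, hmin⟩ := WellFounded.has_min (measure (natDegree (R := k[X]))).wf
    {f | f ∈ I ∧ f ≠ 0} (Submodule.exists_mem_ne_zero_of_ne_bot hbot)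
  let : NormalizedGCDMonoid k[X] := Classical.choice inferInstance
  have hcf := f.eq_C_content_mul_primPart
  have hc : f.content ≠ 0 := fun h => hf0 (content_eq_zero_iff.1 h)
  obtain ⟨a, ha, hdvd⟩ := exists_dvd_C_mul_of_mem hf hf0 (fun g hg hg0 => not_lt.1 (hmin g ⟨hg, hg0⟩)) _
    (hI f hf)
  set c := f.content with hcd
  set p := f.primPart with hpd
  have hp : p.IsPrimitive := f.isPrimitive_primPart
  have hflow : yFlow s t u c₁ c₂ f = C (derivative c) * p + C c * yFlow s t u c₁ c₂ p := by
    conv_lhs => rw [hcf]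
    rw [yFlow, yFlow, coeffDeriv_C_mul, derivative_C_mul]
    ring
  have h1 : p ∣ C (a * c) * yFlow s t u c₁ c₂ p := by
    have h2 : p ∣ C a * yFlow s t u c₁ c₂ f := (Dvd.intro_left _ hcf.symm).trans hdvd
    rw [hflow] at h2
    have h3 := dvd_sub h2 (dvd_mul_left p (C a * C (derivative c)))
    convert h3 using 1
    rw [C_mul]
    ring
  -- Gauss's lemma: for primitive `p`, divisibility may be tested over `k(x)`, where `a * c` is a
  -- unit.
  have h2 : p ∣ yFlow s t u c₁ c₂ p := by
    rw [hp.dvd_iff_fraction_map_dvd_fraction_map (FractionRing k[X])] at h1 ⊢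
    rw [Polynomial.map_mul, map_C] at h1
    refine (IsUnit.dvd_mul_left (isUnit_C.2 (IsUnit.mk0 _ ?_))).1 h1
    exact (map_ne_zero_iff _ (IsFractionRing.injective k[X] _)).2 (mul_ne_zero ha hc)
  obtain ⟨l, hl⟩ := h2
  have hdeg : f.natDegree = 0 := by
    rw [← natDegree_primPart]
    exact natDegree_eq_zero_of_yFlow_eq_mul hs ht hc₁ hc₂ (hl.trans (mul_comm _ _))
  obtain ⟨b, rfl⟩ := natDegree_eq_zero.1 hdeg
  exact eq_top_of_C_mem hI _ b rfl (C_ne_zero.1 hf0) hf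

end Ideals

/-! ### Transport to `MvPolynomial (Fin 2) k` -/

open MvPolynomial in
/-- Here `k[x, y]` is `MvPolynomial (Fin 2) k`, with `x = X 0` and `y = X 1`. -/
theorem theorem3p4 {k : Type*} [Field k] [CharZero k] (s t u : ℕ) (hs : 1 ≤ s) (ht : 1 ≤ t)
    (c₁ c₂ : k) (hc₁ : c₁ ≠ 0) (hc₂ : c₂ ≠ 0) :
    (pderiv 0 + ((X 0 ^ u * (C c₁ * X 0 ^ t * X 1 ^ s + C c₂) : MvPolynomial (Fin 2) k) •
      pderiv 1) : Derivation k (MvPolynomial (Fin 2) k) (MvPolynomial (Fin 2) k)).IsSimpleDerivation := by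
  intro I hI
  set e := Polynomial.Bivariate.equivMvPolynomial k
  have hflow : ∀ p : Polynomial (Polynomial k), e (yFlow s t u c₁ c₂ p) =
      (pderiv 0 + ((X 0 ^ u * (C c₁ * X 0 ^ t * X 1 ^ s + C c₂) : MvPolynomial (Fin 2) k) •
        pderiv 1) : Derivation k (MvPolynomial (Fin 2) k) (MvPolynomial (Fin 2) k)) (e p) := by
    intro p
    rw [Derivation.add_apply, Derivation.smul_apply, smul_eq_mul,
      Polynomial.Bivariate.pderiv_zero_equivMvPolynomial,
      Polynomial.Bivariate.pderiv_one_equivMvPolynomial, yFlow, map_add, map_mul, coeffDeriv]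
    congr 2
    simp [yField, e]
    ring
  rcases eq_bot_or_eq_top_of_yFlow_mem hs ht hc₁ hc₂ (I := I.comap e)
    (fun f hf => by rw [Ideal.mem_comap, hflow]; exact hI _ hf) with h | h
  · left
    rw [eq_bot_iff]
    intro g hg
    have : e.symm g ∈ I.comap e := by simpa [Ideal.mem_comap] using hg
    rw [h, Ideal.mem_bot] at this
    simpa using this
  · right
    rw [Ideal.eq_top_iff_one] at h ⊢
    simpa [Ideal.mem_comap] using h
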